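/- Let $\mathcal{H}$ be a complex separable Hilbert space and let $S:\operatorname{dom}(S)\to\mathcal{H}$ be a closed, densely defined antilinear involution on $\mathcal{H}$ (that is, $S$ maps $\operatorname{dom}(S)$ into itself and $S^2x=x$ for $x\in\operatorname{dom}(S)$). Let $S^*$ be its antilinear adjoint, determined by $\langle S\varphi,\psi\rangle=\langle S^*\psi,\varphi\rangle$ (inner products are linear in the second entry), and let $\mathcal{H}\otimes\mathcal{H}$ be the Hilbert space tensor product. An operator $T\in\mathcal{B}(\mathcal{H}\otimes\mathcal{H})$ is called $S$-crossable if there is a bounded operator $\mathrm{Cross}_S(T)\in\mathcal{B}(\mathcal{H}\otimes\mathcal{H})$, necessarily unique, with $$\langle\varphi_2\otimes S^*\psi_2,\;T(S\varphi_1\otimes\psi_1)\rangle=\langle\varphi_1\otimes\varphi_2,\;\mathrm{Cross}_S(T)(\psi_1\otimes\psi_2)\rangle$$ for all $\varphi_1,\psi_1\in\operatorname{dom}(S)$ and $\varphi_2,\psi_2\in\operatorname{dom}(S^*)$. Let $\mathcal{C}_S\subset\mathcal{B}(\mathcal{H}\otimes\mathcal{H})$ be the set of all $S$-crossable operators. Then: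 a) $\mathcal{C}_S$ is a complex linear subspace of $\mathcal{B}(\mathcal{H}\otimes\mathcal{H})$ that is dense in the strong and in the weak operator topology, and $\mathrm{Cross}_S:\mathcal{C}_S\to\mathcal{B}(\mathcal{H}\otimes\mathcal{H})$ is an injective complex linear map. b) If $\mathcal{B}(\mathcal{H}\otimes\mathcal{H})$ carries the norm topology, the strong operator topology or the weak operator topology, then $\mathrm{Cross}_S$ is a closed linear map, i.e. its graph is closed in $\mathcal{B}(\mathcal{H}\otimes\mathcal{H})\times\mathcal{B}(\mathcal{H}\otimes\mathcal{H})$ for the corresponding product topology. c) For each of these three topologies (taken on the domain $\mathcal{C}_S$ and on the target), $\mathrm{Cross}_S$ is continuous if and only if $\dim\mathcal{H}<\infty$, and $\mathcal{C}_S$ is closed if and only if $\dim\mathcal{H}<\infty$. If $\dim\mathcal{H}<\infty$, then $\mathcal{C}_S=\mathcal{B}(\mathcal{H}\otimes\mathcal{H})$. -/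

import Mathlib

open scoped TensorProduct Topology

noncomputable section

namespace Crossing

variable {H : Type*} [NormedAddCommGroup H] [InnerProductSpace ℂ H]

/-! ### The Hilbert space tensor square -/

/-- The Hilbert space tensor product of `H` with itself: the completion of the algebraic tensor
product with respect to `⟪a ⊗ b, c ⊗ d⟫ = ⟪a, c⟫ * ⟪b, d⟫`. -/
abbrev TensorSq (H : Type*) [NormedAddCommGroup H] [InnerProductSpace ℂ H] : Type _ :=
  UniformSpace.Completion (H ⊗[ℂ] H)

/-- The elementary tensor of `x` and `y` in the Hilbert space tensor square. -/
def tmul (x y : H) : TensorSq H := ((x ⊗ₜ[ℂ] y : H ⊗[ℂ] H) : TensorSq H)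

/-- The bounded operators on the Hilbert space tensor square. -/
abbrev BoundedOp (H : Type*) [NormedAddCommGroup H] [InnerProductSpace ℂ H] : Type _ :=
  TensorSq H →L[ℂ] TensorSq H

/-! ### The three operator topologies -/

/-- The operator norm topology. -/
abbrev normTopology (H : Type*) [NormedAddCommGroup H] [InnerProductSpace ℂ H] :
    TopologicalSpace (BoundedOp H) := inferInstance

/-- The strong operator topology (pointwise norm convergence). -/
abbrev strongTopology (H : Type*) [NormedAddCommGroup H] [InnerProductSpace ℂ H] :
    TopologicalSpace (BoundedOp H) :=
  TopologicalSpace.induced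
    (ContinuousLinearMap.toPointwiseConvergenceCLM ℂ (RingHom.id ℂ) (TensorSq H) (TensorSq H))
    inferInstance

/-- The weak operator topology (pointwise weak convergence). -/
abbrev weakTopology (H : Type*) [NormedAddCommGroup H] [InnerProductSpace ℂ H] :
    TopologicalSpace (BoundedOp H) :=
  TopologicalSpace.induced
    (ContinuousLinearMapWOT.ofCLM : BoundedOp H → (TensorSq H →WOT[ℂ] TensorSq H)) inferInstance

/-! ### Antilinear operators -/

/-- The adjoint of a densely defined antilinear operator `A`: `ψ` lies in its domain if
and only if there is `η` with `⟪A φ, ψ⟫ = ⟪η, φ⟫` for all `φ` in the domain of `A`, and then it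
maps `ψ` to this (unique) `η`. -/
def antiAdjoint (A : H →ₛₗ.[starRingEnd ℂ] H) (hA : Dense (A.domain : Set H)) :
    H →ₛₗ.[starRingEnd ℂ] H where
  domain :=
    { carrier := {ψ | ∃ η : H, ∀ φ : A.domain, inner ℂ (A φ) ψ = inner ℂ η (φ : H)}
      zero_mem' := ⟨0, fun φ => by simp⟩
      add_mem' := by
        rintro a b ⟨η, hη⟩ ⟨ξ, hξ⟩
        exact ⟨η + ξ, fun φ => by rw [inner_add_right, inner_add_left, hη, hξ]⟩
      smul_mem' := by
        rintro c a ⟨η, hη⟩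
        exact ⟨starRingEnd ℂ c • η, fun φ => by
          rw [inner_smul_right, inner_smul_left, hη, Complex.conj_conj]⟩ }
  toFun :=
    { toFun := fun ψ => ψ.2.choose
      map_add' := fun a b => hA.eq_of_inner_left ℂ fun z hz => by
        rw [inner_add_left, ← (a + b).2.choose_spec ⟨z, hz⟩, ← a.2.choose_spec ⟨z, hz⟩,
          ← b.2.choose_spec ⟨z, hz⟩]
        exact inner_add_right _ _ _
      map_smul' := fun c a => hA.eq_of_inner_left ℂ fun z hz => by
        rw [inner_smul_left, Complex.conj_conj, ← (c • a).2.choose_spec ⟨z, hz⟩,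
          ← a.2.choose_spec ⟨z, hz⟩]
        exact inner_smul_right _ _ _ }

theorem mem_antiAdjoint_domain {A : H →ₛₗ.[starRingEnd ℂ] H} {hA : Dense (A.domain : Set H)}
    {ψ : H} : ψ ∈ (antiAdjoint A hA).domain ↔
      ∃ η : H, ∀ φ : A.domain, inner ℂ (A φ) ψ = inner ℂ η (φ : H) := Iff.rfl

theorem inner_antiAdjoint {A : H →ₛₗ.[starRingEnd ℂ] H} {hA : Dense (A.domain : Set H)}
    (ψ : (antiAdjoint A hA).domain) (φ : A.domain) :
    inner ℂ (A φ) (ψ : H) = inner ℂ (antiAdjoint A hA ψ) (φ : H) :=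
  ψ.2.choose_spec φ

/-- A densely defined closed antilinear involution `S` on `H`: `S` maps its domain into itself and
`S (S x) = x` there. -/
structure ClosedInvolution (H : Type*) [NormedAddCommGroup H] [InnerProductSpace ℂ H] where
  /-- The underlying partially defined antilinear map. -/
  op : H →ₛₗ.[starRingEnd ℂ] H
  dense_domain : Dense (op.domain : Set H)
  isClosed_graph : IsClosed (Set.range fun x : op.domain => ((x : H), op x))
  map_mem : ∀ x : op.domain, op x ∈ op.domain
  map_map : ∀ x : op.domain, op ⟨op x, map_mem x⟩ = x

namespace ClosedInvolution

/-- The adjoint of `S`. -/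
def adjoint (S : ClosedInvolution H) : H →ₛₗ.[starRingEnd ℂ] H :=
  antiAdjoint S.op S.dense_domain

/-! ### The crossing map -/

/-- The form `Q_S(T)` on elementary tensors `φ₁ ⊗ φ₂` and `ψ₁ ⊗ ψ₂` of the algebraic tensor product
of the domains of `S` and of its adjoint. -/
def form (S : ClosedInvolution H) (T : BoundedOp H) (φ₁ : S.op.domain) (φ₂ : S.adjoint.domain)
    (ψ₁ : S.op.domain) (ψ₂ : S.adjoint.domain) : ℂ :=
  inner ℂ (tmul (φ₂ : H) (S.adjoint ψ₂)) (T (tmul (S.op φ₁) (ψ₁ : H)))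

/-- `X` is an `S`-crossed version of `T`. -/
def IsCrossedVersion (S : ClosedInvolution H) (T X : BoundedOp H) : Prop :=
  ∀ (φ₁ ψ₁ : S.op.domain) (φ₂ ψ₂ : S.adjoint.domain),
    S.form T φ₁ φ₂ ψ₁ ψ₂ = inner ℂ (tmul (φ₁ : H) (φ₂ : H)) (X (tmul (ψ₁ : H) (ψ₂ : H)))

/-- The set of all `S`-crossable operators. -/
def crossable (S : ClosedInvolution H) : Set (BoundedOp H) :=
  {T | ∃ X, S.IsCrossedVersion T X}

/-- The `S`-crossing map: it maps an `S`-crossable operator to its `S`-crossed version, which is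
unique by `ClosedInvolution.IsCrossedVersion.unique` below. -/
def crossingMap (S : ClosedInvolution H) (T : S.crossable) : BoundedOp H := T.2.choose

theorem crossingMap_spec (S : ClosedInvolution H) (T : S.crossable) :
    S.IsCrossedVersion T (S.crossingMap T) := T.2.choose_spec

/-! ### Uniqueness of the crossed version -/

theorem dense_adjoint_domain [CompleteSpace H] (S : ClosedInvolution H) :
    Dense (S.adjoint.domain : Set H) := by
  rw [Submodule.dense_iff_topologicalClosure_eq_top, Submodule.topologicalClosure_eq_top_iff,
    Submodule.eq_bot_iff]
  intro v hv
  let _ : InnerProductSpace ℝ H := InnerProductSpace.complexToReal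
  -- the graph of `S`, a closed real subspace of `H × H`
  let K : Submodule ℝ (WithLp 2 (H × H)) :=
    { carrier := {p | ∃ x : S.op.domain, (x : H) = p.fst ∧ S.op x = p.snd}
      zero_mem' := ⟨0, by simp⟩
      add_mem' := by
        rintro p q ⟨x, hx, hx'⟩ ⟨y, hy, hy'⟩
        exact ⟨x + y, by simp [hx, hy], by simp [LinearPMap.map_add, hx', hy']⟩
      smul_mem' := by
        rintro c p ⟨x, hx, hx'⟩
        refine ⟨(c : ℂ) • x, by simp [hx], ?_⟩
        rw [LinearPMap.map_smulₛₗ, hx']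
        simp }
  have hK : IsClosed (K : Set (WithLp 2 (H × H))) := by
    have h := S.isClosed_graph.preimage (WithLp.prod_continuous_ofLp 2 H H)
    convert h using 1
    ext p
    simp only [Set.mem_preimage, Set.mem_range, Prod.ext_iff]
    rfl
  have : CompleteSpace K := hK.completeSpace_coe
  obtain ⟨p, hp, q, hq, hpq⟩ :=
    Submodule.exists_add_mem_mem_orthogonal (𝕜 := ℝ) (E := WithLp 2 (H × H)) (K := K) (WithLp.toLp 2 ((0 : H), v))
  obtain ⟨x, hx, hSx⟩ := hp
  have h1 : (x : H) + q.fst = 0 := by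
    rw [hx]; exact (congrArg WithLp.fst hpq).symm
  have h2 : S.op x + q.snd = v := by
    rw [hSx]; exact (congrArg WithLp.snd hpq).symm
  have hre : ∀ y : S.op.domain,
      (inner ℂ (y : H) q.fst).re + (inner ℂ (S.op y) q.snd).re = 0 := by
    intro y
    have := (Submodule.mem_orthogonal K q).1 hq (WithLp.toLp 2 ((y : H), S.op y)) ⟨y, rfl, rfl⟩
    rw [WithLp.prod_inner_apply] at this
    exact this
  have hadj : ∀ y : S.op.domain, inner ℂ (S.op y) q.snd = inner ℂ (x : H) (y : H) := by
    intro y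
    have e1 := hre y
    have e2 := hre (Complex.I • y)
    rw [LinearPMap.map_smulₛₗ] at e2
    rw [eq_neg_of_add_eq_zero_right h1] at e1 e2
    simp only [Submodule.coe_smul, inner_smul_left, inner_neg_right] at e1 e2
    rw [← inner_conj_symm (x : H) (y : H)]
    apply Complex.ext
    · simp only [Complex.neg_re, Complex.conj_re] at e1 ⊢
      linarith
    · simp only [Complex.neg_re, Complex.conj_im, Complex.mul_re, Complex.conj_re, Complex.I_re,
        Complex.I_im] at e2 ⊢
      linarith
  have hmem : q.snd ∈ S.adjoint.domain := ⟨x, hadj⟩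
  have h3 : inner ℂ q.snd v = 0 := (Submodule.mem_orthogonal _ v).1 hv _ hmem
  have h4 := hadj x
  have h5 : inner ℂ q.snd v = inner ℂ q.snd (S.op x) + inner ℂ q.snd q.snd := by
    rw [← inner_add_right, h2]
  rw [h3, ← inner_conj_symm, h4, inner_self_eq_norm_sq_to_K, inner_self_eq_norm_sq_to_K] at h5
  have h6 : (0 : ℝ) = ‖(x : H)‖ ^ 2 + ‖q.snd‖ ^ 2 := by
    have := congrArg Complex.re h5
    simpa [← Complex.ofReal_pow] using this
  have h7 : ‖(x : H)‖ = 0 := by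
    have := sq_nonneg ‖q.snd‖
    exact pow_eq_zero_iff (two_ne_zero) |>.1 (le_antisymm (by linarith) (sq_nonneg _))
  have h8 : q.snd = 0 := by
    rw [h7] at h6
    exact norm_eq_zero.1 (pow_eq_zero_iff (two_ne_zero) |>.1 (by linarith))
  have h9 : x = 0 := Subtype.ext (norm_eq_zero.1 h7)
  rw [← h2, h8, h9, LinearPMap.map_zero, add_zero]

theorem eq_zero_of_inner_tmul {D E : Submodule ℂ H} (hD : Dense (D : Set H))
    (hE : Dense (E : Set H)) {z : TensorSq H}
    (h : ∀ x ∈ D, ∀ y ∈ E, inner ℂ (tmul x y) z = 0) : z = 0 := by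
  have cl : ∀ y : H, Continuous fun x : H => tmul x y := fun y =>
    (UniformSpace.Completion.continuous_coe _).comp
      (((TensorProduct.mk ℂ H H).flip y).mkContinuous ‖y‖ fun x => by
        simp [mul_comm]).continuous
  have cr : ∀ x : H, Continuous fun y : H => tmul x y := fun x =>
    (UniformSpace.Completion.continuous_coe _).comp
      ((TensorProduct.mk ℂ H H x).mkContinuous ‖x‖ fun y => by simp).continuous
  have h1 : ∀ x ∈ D, ∀ y, inner ℂ (tmul x y) z = 0 := fun x hx y =>
    congrFun (Continuous.ext_on hE ((cr x).inner continuous_const) continuous_const (h x hx)) y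
  have h2 : ∀ x y, inner ℂ (tmul x y) z = 0 := fun x y =>
    congrFun (Continuous.ext_on hD ((cl y).inner continuous_const) continuous_const
      fun x hx => h1 x hx y) x
  have h3 : ∀ w : TensorSq H, inner ℂ w z = 0 := by
    intro w
    induction w using UniformSpace.Completion.induction_on with
    | hp => exact isClosed_eq (continuous_id.inner continuous_const) continuous_const
    | ih a =>
      induction a using TensorProduct.induction_on with
      | zero => rw [UniformSpace.Completion.coe_zero, inner_zero_left]
      | tmul x y => exact h2 x y
      | add a b ha hb => rw [UniformSpace.Completion.coe_add, inner_add_left, ha, hb, add_zero]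
  exact inner_self_eq_zero.1 (h3 z)

theorem IsCrossedVersion.unique [CompleteSpace H] {S : ClosedInvolution H} {T X Y : BoundedOp H}
    (hX : S.IsCrossedVersion T X) (hY : S.IsCrossedVersion T Y) : X = Y := by
  have h1 : ∀ (ψ₁ : S.op.domain) (ψ₂ : S.adjoint.domain),
      (X - Y) (tmul (ψ₁ : H) (ψ₂ : H)) = 0 := fun ψ₁ ψ₂ =>
    eq_zero_of_inner_tmul S.dense_domain S.dense_adjoint_domain fun φ₁ h₁ φ₂ h₂ => by
      rw [sub_apply, inner_sub_right, ← hX ⟨φ₁, h₁⟩ ψ₁ ⟨φ₂, h₂⟩ ψ₂,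
        ← hY ⟨φ₁, h₁⟩ ψ₁ ⟨φ₂, h₂⟩ ψ₂, sub_self]
  have h2 : ContinuousLinearMap.adjoint (X - Y) = 0 := by
    ext1 w
    refine eq_zero_of_inner_tmul S.dense_domain S.dense_adjoint_domain fun ψ₁ h₁ ψ₂ h₂ => ?_
    rw [ContinuousLinearMap.adjoint_inner_right, h1 ⟨ψ₁, h₁⟩ ⟨ψ₂, h₂⟩, inner_zero_left]
  exact sub_eq_zero.1 ((map_eq_zero_iff _ ContinuousLinearMap.adjoint.injective).1 h2)

end ClosedInvolution

end Crossing

end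

noncomputable section

namespace Crossing

variable {H : Type*} [NormedAddCommGroup H] [InnerProductSpace ℂ H]

/-! ### Linear maps on subspaces of normed spaces -/

/-! Everything rests on one explicit family (`isCrossedVersion_rankOne`): for x₂ ∈ dom S and y₁ ∈
dom S*, the operator |x₁ ⊗ x₂⟩⟨y₁ ⊗ y₂| crosses to |S*y₁ ⊗ x₁⟩⟨y₂ ⊗ Sx₂|. The norm closure of the
crossable operators therefore contains every rank-one operator, and finite-rank operators are
strongly dense. Injectivity holds because S and S* are involutions, so the form tests T on all of
their dense domains. The graph is closed because it is cut out by equalities of weakly continuous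
functionals.

In part c), continuity gives a norm bound on the crossing map over the unit ball, by uniform
boundedness; closedness of the domain reduces to continuity, by the closed graph theorem. Such a
bound forces finite dimension (`finiteDimensional_of_norm_le`): a sum of n mutually orthogonal
rank-one projections has norm at most 1, but crosses to a rank-one operator whose norm grows like
√n. Conversely, in finite dimension the topologies agree and a dense subspace is everything. -/

theorem continuous_of_isClosed_submodule_of_isClosed_graph {E F : Type*} [NormedAddCommGroup E]
    [NormedAddCommGroup F] [NormedSpace ℂ E] [NormedSpace ℂ F] [CompleteSpace E] [CompleteSpace F]
    (M : Submodule ℂ E) (hM : IsClosed (M : Set E)) (f : M →ₗ[ℂ] F)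
    (h : IsClosed (Set.range fun x : M => ((x : E), f x))) : Continuous f := by
  have : CompleteSpace M := hM.completeSpace_coe
  refine f.continuous_of_isClosed_graph ?_
  convert h.preimage (f := Prod.map (Subtype.val : M → E) id)
    (continuous_subtype_val.prodMap continuous_id) using 1
  ext ⟨T, X⟩
  simp [eq_comm]

theorem exists_norm_le_of_continuous {E F : Type*} [NormedAddCommGroup E] [NormedAddCommGroup F]
    [NormedSpace ℂ E] [NormedSpace ℂ F] (M : Submodule ℂ E) (f : M →ₗ[ℂ] F) (hf : Continuous f) :
    ∃ C, ∀ T : M, ‖T‖ ≤ 1 → ‖f T‖ ≤ C :=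
  ⟨‖(⟨f, hf⟩ : M →L[ℂ] F)‖, fun T hT => (⟨f, hf⟩ : M →L[ℂ] F).unit_le_opNorm T hT⟩

theorem norm_sum_rankOne_le {E ι : Type*} [NormedAddCommGroup E] [InnerProductSpace ℂ E]
    [Fintype ι] {f : ι → E} (hf : Orthonormal ℂ f) :
    ‖∑ i, InnerProductSpace.rankOne ℂ (f i) (f i)‖ ≤ 1 := by
  refine ContinuousLinearMap.opNorm_le_bound _ zero_le_one fun z => ?_
  rw [one_mul, ← sq_le_sq₀ (norm_nonneg _) (norm_nonneg _)]
  -- Bessel's inequality; the left side is the squared norm of the projection of z.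
  refine le_of_eq_of_le ?_ (hf.sum_inner_products_le (s := Finset.univ) z)
  have := hf.inner_sum (fun i => inner ℂ (f i) z) (fun i => inner ℂ (f i) z) Finset.univ
  rw [inner_self_eq_norm_sq_to_K] at this
  simp only [Complex.conj_mul'] at this
  simp only [sum_apply, InnerProductSpace.rankOne_apply]
  rw [← Complex.ofReal_inj]
  push_cast
  exact this

theorem exists_orthonormal_of_dense {E : Type*} [NormedAddCommGroup E] [InnerProductSpace ℂ E]
    (hE : ¬ FiniteDimensional ℂ E) {D : Submodule ℂ E} (hD : Dense (D : Set E)) :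
    ∃ y : ℕ → D, Orthonormal ℂ fun i => (y i : E) := by
  -- A finite-dimensional subspace is closed, so a dense one would be all of E.
  have hfin : ¬ FiniteDimensional ℂ D := fun _ => hE <| by
    have hc : IsClosed (D : Set E) := D.closed_of_finiteDimensional
    have : D = ⊤ := SetLike.coe_injective (hc.closure_eq.symm.trans hD.closure_eq)
    exact Module.Finite.of_surjective D.subtype (by rw [← LinearMap.range_eq_top]; simpa)
  let b := Module.Basis.ofVectorSpace ℂ D
  have : Infinite (Module.Basis.ofVectorSpaceIndex ℂ D) := by
    by_contra h
    rw [not_infinite_iff_finite] at h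
    exact hfin (Module.Finite.of_basis b)
  have hl := b.linearIndependent.comp _ (Infinite.natEmbedding _).injective
  exact ⟨_, (InnerProductSpace.gramSchmidtNormed_orthonormal hl).comp_linearIsometry D.subtypeₗᵢ⟩

/-! ### Elementary tensors -/

@[simp]
theorem inner_tmul_tmul (a b c d : H) :
    inner ℂ (tmul a b) (tmul c d) = inner ℂ a c * inner ℂ b d := by
  simp [tmul, UniformSpace.Completion.inner_coe]

@[simp]
theorem norm_tmul (a b : H) : ‖tmul a b‖ = ‖a‖ * ‖b‖ := by
  simp [tmul, UniformSpace.Completion.norm_coe]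

theorem eq_top_of_tmul_mem {D E : Submodule ℂ H} (hD : Dense (D : Set H))
    (hE : Dense (E : Set H)) {M : Submodule ℂ (TensorSq H)}
    (hM : IsClosed (M : Set (TensorSq H))) (h : ∀ x ∈ D, ∀ y ∈ E, tmul x y ∈ M) : M = ⊤ := by
  rw [← hM.submodule_topologicalClosure_eq, Submodule.topologicalClosure_eq_top_iff,
    Submodule.eq_bot_iff]
  intro z hz
  exact ClosedInvolution.eq_zero_of_inner_tmul hD hE fun x hx y hy =>
    (Submodule.mem_orthogonal M z).1 hz _ (h x hx y hy)

/-! ### Comparison of the operator topologies -/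

theorem norm_le_strong : normTopology H ≤ strongTopology H := by
  rw [← continuous_iff_le_induced]
  exact ContinuousLinearMap.continuous _

theorem strong_le_weak : strongTopology H ≤ weakTopology H := by
  rw [← continuous_iff_le_induced]
  let _ : TopologicalSpace (BoundedOp H) := strongTopology H
  refine ContinuousLinearMapWOT.continuous_of_dual_apply_continuous fun x y => ?_
  have hx : Continuous fun A : TensorSq H →Lₚₜ[ℂ] TensorSq H => y (A x) :=
    y.continuous.comp (continuous_eval_const x)
  exact hx.comp continuous_induced_dom

theorem norm_le_weak : normTopology H ≤ weakTopology H :=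
  norm_le_strong.trans strong_le_weak

theorem norm_le_and_le_weak {t : TopologicalSpace (BoundedOp H)}
    (ht : t ∈ ({normTopology H, strongTopology H, weakTopology H} :
      Set (TopologicalSpace (BoundedOp H)))) :
    normTopology H ≤ t ∧ t ≤ weakTopology H := by
  rcases ht with rfl | rfl | rfl
  · exact ⟨le_rfl, norm_le_weak⟩
  · exact ⟨norm_le_strong, strong_le_weak⟩
  · exact ⟨norm_le_weak, le_rfl⟩

theorem continuous_weak_inner (a b : TensorSq H) :
    Continuous[weakTopology H, inferInstance] fun T : BoundedOp H => inner ℂ a (T b) := by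
  let _ : TopologicalSpace (BoundedOp H) := weakTopology H
  exact (ContinuousLinearMapWOT.continuous_dual_apply b (innerSL ℂ a)).comp
    (continuous_induced_dom (f := (ContinuousLinearMapWOT.ofCLM :
      BoundedOp H → (TensorSq H →WOT[ℂ] TensorSq H))))

instance [FiniteDimensional ℂ H] : FiniteDimensional ℂ (TensorSq H) := by
  have : FiniteDimensional ℂ (H ⊗[ℂ] H) := inferInstance
  have : CompleteSpace (H ⊗[ℂ] H) := FiniteDimensional.complete ℂ _
  have hs : Function.Surjective
      (UniformSpace.Completion.toComplL : H ⊗[ℂ] H →L[ℂ] TensorSq H) := by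
    intro z
    have hr : IsClosed (Set.range ((↑) : H ⊗[ℂ] H → TensorSq H)) :=
      (UniformSpace.Completion.isUniformEmbedding_coe _).isClosedEmbedding.isClosed_range
    have := UniformSpace.Completion.denseRange_coe (α := H ⊗[ℂ] H) z
    rwa [hr.closure_eq] at this
  exact Module.Finite.of_surjective
    (UniformSpace.Completion.toComplL : H ⊗[ℂ] H →L[ℂ] TensorSq H).toLinearMap hs

/-- The identity from the weak to the norm topology is linear on a finite-dimensional space, hence
continuous. -/
theorem weak_eq_norm [FiniteDimensional ℂ H] : weakTopology H = normTopology H := by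
  refine le_antisymm ?_ norm_le_weak
  have : FiniteDimensional ℂ (TensorSq H →WOT[ℂ] TensorSq H) :=
    Module.Finite.equiv (ContinuousLinearMapWOT.linearEquiv (σ := RingHom.id ℂ)
      (E := TensorSq H) (F := TensorSq H) ℂ).symm
  have hc := LinearMap.continuous_of_finiteDimensional
    (ContinuousLinearMapWOT.linearEquiv (σ := RingHom.id ℂ)
      (E := TensorSq H) (F := TensorSq H) ℂ).toLinearMap
  have h := induced_mono (g := (ContinuousLinearMapWOT.ofCLM :
    BoundedOp H → (TensorSq H →WOT[ℂ] TensorSq H))) (continuous_iff_le_induced.1 hc)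
  rw [induced_compose] at h
  exact h.trans_eq induced_id

theorem dense_strong_of_rankOne_mem {M : Submodule ℂ (BoundedOp H)}
    (h : ∀ x y : TensorSq H, InnerProductSpace.rankOne ℂ x y ∈ M.topologicalClosure) :
    @Dense _ (strongTopology H) (M : Set (BoundedOp H)) := by
  classical
  intro T
  have h1 : (M.topologicalClosure : Set (BoundedOp H)) ⊆
      @closure _ (strongTopology H) (M : Set (BoundedOp H)) := fun A hA => by
    rw [Submodule.topologicalClosure_coe] at hA
    rw [@mem_closure_iff] at hA ⊢
    exact fun o ho => hA o (norm_le_strong o ho)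
  let P : Finset (TensorSq H) → BoundedOp H := fun F =>
    (Submodule.span ℂ (F : Set (TensorSq H))).starProjection
  have h2 : ∀ F, T ∘L P F ∈ M.topologicalClosure := fun F => by
    let e := stdOrthonormalBasis ℂ (Submodule.span ℂ (F : Set (TensorSq H)))
    have : T ∘L P F = ∑ i, InnerProductSpace.rankOne ℂ (T (e i)) (e i : TensorSq H) := by
      ext1 z
      simp only [P, ContinuousLinearMap.comp_apply, sum_apply,
        InnerProductSpace.rankOne_apply, Submodule.starProjection_apply,
        e.orthogonalProjectionOnto_apply_eq_sum, Submodule.coe_sum, Submodule.coe_smul, map_sum,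
        map_smul]
    rw [this]
    exact Submodule.sum_mem _ fun i _ => h _ _
  let _ : TopologicalSpace (BoundedOp H) := strongTopology H
  have h3 : Filter.Tendsto (fun F => T ∘L P F) Filter.atTop (𝓝 T) := by
    rw [nhds_induced, Filter.tendsto_comap_iff,
      PointwiseConvergenceCLM.tendsto_iff_forall_tendsto]
    intro x
    -- At a fixed x the net is eventually constant: `P F` fixes x as soon as x ∈ F.
    refine Filter.Tendsto.congr' ?_ tendsto_const_nhds
    filter_upwards [Filter.eventually_ge_atTop {x}] with F hF
    have : P F x = x := Submodule.starProjection_eq_self_iff.2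
      (Submodule.subset_span (hF (Finset.mem_singleton_self x)))
    exact (congrArg T this).symm
  exact closure_closure (s := (M : Set (BoundedOp H))) ▸
    mem_closure_of_tendsto h3 (Filter.Eventually.of_forall fun F => h1 (h2 F))

namespace ClosedInvolution

/-! ### The adjoint of a closed involution -/

variable (S : ClosedInvolution H)

theorem inner_adjoint (ψ : S.adjoint.domain) (φ : S.op.domain) :
    inner ℂ (S.op φ) (ψ : H) = inner ℂ (S.adjoint ψ) (φ : H) :=
  inner_antiAdjoint ψ φ

/-- Substituting Sφ for φ in the adjoint relation; this makes S* an involution of its own domain. -/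
theorem inner_op_adjoint (ψ : S.adjoint.domain) (φ : S.op.domain) :
    inner ℂ (S.op φ) (S.adjoint ψ) = inner ℂ (ψ : H) (φ : H) := by
  have h := S.inner_adjoint ψ ⟨S.op φ, S.map_mem φ⟩
  rw [S.map_map] at h
  rw [← inner_conj_symm, ← h, inner_conj_symm]

theorem adjoint_mem (ψ : S.adjoint.domain) : S.adjoint ψ ∈ S.adjoint.domain :=
  mem_antiAdjoint_domain.2 ⟨ψ, S.inner_op_adjoint ψ⟩

theorem adjoint_adjoint (ψ : S.adjoint.domain) :
    S.adjoint ⟨S.adjoint ψ, S.adjoint_mem ψ⟩ = ψ :=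
  S.dense_domain.eq_of_inner_left ℂ fun z hz => by
    rw [← S.inner_adjoint _ ⟨z, hz⟩, S.inner_op_adjoint]

/-! ### Linearity and injectivity of the crossing map -/

variable {S}

theorem IsCrossedVersion.zero : S.IsCrossedVersion 0 0 := fun φ₁ ψ₁ φ₂ ψ₂ => by
  simp [form]

theorem IsCrossedVersion.add {T T' X X' : BoundedOp H} (h : S.IsCrossedVersion T X)
    (h' : S.IsCrossedVersion T' X') : S.IsCrossedVersion (T + T') (X + X') :=
  fun φ₁ ψ₁ φ₂ ψ₂ => by
    have e := h φ₁ ψ₁ φ₂ ψ₂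
    have e' := h' φ₁ ψ₁ φ₂ ψ₂
    simp only [form] at e e' ⊢
    rw [add_apply, add_apply, inner_add_right, inner_add_right, e, e']

theorem IsCrossedVersion.smul {T X : BoundedOp H} (c : ℂ) (h : S.IsCrossedVersion T X) :
    S.IsCrossedVersion (c • T) (c • X) := fun φ₁ ψ₁ φ₂ ψ₂ => by
  have e := h φ₁ ψ₁ φ₂ ψ₂
  simp only [form] at e ⊢
  rw [smul_apply, smul_apply, inner_smul_right, inner_smul_right, e]

theorem IsCrossedVersion.sum {ι : Type*} (s : Finset ι) {T X : ι → BoundedOp H}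
    (h : ∀ i, S.IsCrossedVersion (T i) (X i)) :
    S.IsCrossedVersion (∑ i ∈ s, T i) (∑ i ∈ s, X i) := by
  classical
  induction s using Finset.induction_on with
  | empty => simpa using IsCrossedVersion.zero
  | insert i s hi ih => simpa [Finset.sum_insert hi] using (h i).add ih

theorem isCrossedVersion_rankOne (x₁ y₂ : H) (x₂ : S.op.domain) (y₁ : S.adjoint.domain) :
    S.IsCrossedVersion (InnerProductSpace.rankOne ℂ (tmul x₁ (x₂ : H)) (tmul (y₁ : H) y₂))
      (InnerProductSpace.rankOne ℂ (tmul (S.adjoint y₁) x₁) (tmul y₂ (S.op x₂))) :=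
  fun φ₁ ψ₁ φ₂ ψ₂ => by
    simp only [form, InnerProductSpace.rankOne_apply, inner_smul_right, inner_tmul_tmul]
    rw [← S.inner_adjoint ψ₂ x₂, ← inner_conj_symm (y₁ : H), S.inner_adjoint y₁ φ₁,
      inner_conj_symm]
    ring

/-- Evaluating the form at Sx and S*w cancels both involutions, leaving plain matrix elements of T
on dense sets of elementary tensors. -/
theorem IsCrossedVersion.eq_zero [CompleteSpace H] {T : BoundedOp H}
    (h : S.IsCrossedVersion T 0) : T = 0 := by
  have h1 : ∀ (x y : S.op.domain) (z w : S.adjoint.domain),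
      inner ℂ (tmul (z : H) (w : H)) (T (tmul (x : H) (y : H))) = 0 := fun x y z w => by
    have e := h ⟨S.op x, S.map_mem x⟩ y z ⟨S.adjoint w, S.adjoint_mem w⟩
    rw [form, S.map_map, S.adjoint_adjoint] at e
    simpa using e
  have h2 : T.ker = ⊤ := eq_top_of_tmul_mem S.dense_domain S.dense_domain T.isClosed_ker
    fun x hx y hy => eq_zero_of_inner_tmul S.dense_adjoint_domain S.dense_adjoint_domain
      fun z hz w hw => h1 ⟨x, hx⟩ ⟨y, hy⟩ ⟨z, hz⟩ ⟨w, hw⟩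
  exact ContinuousLinearMap.coe_injective (LinearMap.ker_eq_top.1 h2)

theorem crossingMap_injective [CompleteSpace H] : Function.Injective S.crossingMap := by
  intro T T' h
  have h1 := (S.crossingMap_spec T).add ((S.crossingMap_spec T').smul (-1))
  rw [h, neg_one_smul, neg_one_smul, add_neg_cancel, ← sub_eq_add_neg] at h1
  exact Subtype.ext (sub_eq_zero.1 h1.eq_zero)

variable (S)

/-- The crossable operators, as a linear subspace. -/
def crossableSubmodule : Submodule ℂ (BoundedOp H) where
  carrier := S.crossable
  zero_mem' := ⟨0, .zero⟩
  add_mem' := fun ⟨_, h⟩ ⟨_, h'⟩ => ⟨_, h.add h'⟩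
  smul_mem' := fun c _ ⟨_, h⟩ => ⟨_, h.smul c⟩

/-- The crossing map, as a linear map. -/
def crossingLinearMap [CompleteSpace H] : S.crossableSubmodule →ₗ[ℂ] BoundedOp H where
  toFun := S.crossingMap
  map_add' T T' := (S.crossingMap_spec (T + T')).unique
    ((S.crossingMap_spec T).add (S.crossingMap_spec T'))
  map_smul' c T := (S.crossingMap_spec (c • T)).unique ((S.crossingMap_spec T).smul c)

variable {S}

theorem mem_range_crossingMap_iff [CompleteSpace H] {p : BoundedOp H × BoundedOp H} :
    p ∈ Set.range (fun T : S.crossable => ((T : BoundedOp H), S.crossingMap T)) ↔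
      S.IsCrossedVersion p.1 p.2 := by
  constructor
  · rintro ⟨T, rfl⟩
    exact S.crossingMap_spec T
  · exact fun h => ⟨⟨p.1, p.2, h⟩, Prod.ext rfl ((S.crossingMap_spec ⟨p.1, p.2, h⟩).unique h)⟩

/-! ### Density of the crossable operators -/

/-- Two density passes from the explicit rank-one family: first in x, with y an elementary tensor,
then in y, where the dependence is antilinear. -/
theorem rankOne_mem_closure_crossable [CompleteSpace H] (x y : TensorSq H) :
    InnerProductSpace.rankOne ℂ x y ∈ S.crossableSubmodule.topologicalClosure := by
  set M := S.crossableSubmodule.topologicalClosure with hM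
  have hMc : IsClosed (M : Set (BoundedOp H)) := Submodule.isClosed_topologicalClosure _
  have h1 : ∀ (y₁ : S.adjoint.domain) (y₂ : H) (x : TensorSq H),
      InnerProductSpace.rankOne ℂ x (tmul (y₁ : H) y₂) ∈ M := fun y₁ y₂ x => by
    let f : TensorSq H →L[ℂ] BoundedOp H :=
      (InnerProductSpace.rankOne ℂ : TensorSq H →L[ℂ] TensorSq H →L⋆[ℂ] BoundedOp H).flip
        (tmul (y₁ : H) y₂)
    have : M.comap f.toLinearMap = ⊤ := eq_top_of_tmul_mem (D := ⊤) dense_univ S.dense_domain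
      (hMc.preimage f.continuous) fun x₁ _ x₂ hx₂ => Submodule.le_topologicalClosure _
        ⟨_, isCrossedVersion_rankOne x₁ y₂ ⟨x₂, hx₂⟩ y₁⟩
    exact (this ▸ Submodule.mem_top : x ∈ M.comap f.toLinearMap)
  have : M.comap (InnerProductSpace.rankOne ℂ x : TensorSq H →L⋆[ℂ] BoundedOp H).toLinearMap = ⊤ :=
    eq_top_of_tmul_mem (E := ⊤) S.dense_adjoint_domain dense_univ
      (hMc.preimage (InnerProductSpace.rankOne ℂ x : TensorSq H →L⋆[ℂ] BoundedOp H).continuous)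
      fun y₁ hy₁ y₂ _ => h1 ⟨y₁, hy₁⟩ y₂ x
  exact (this ▸ Submodule.mem_top : y ∈ M.comap
    (InnerProductSpace.rankOne ℂ x : TensorSq H →L⋆[ℂ] BoundedOp H).toLinearMap)

theorem dense_strong_crossable [CompleteSpace H] : @Dense _ (strongTopology H) S.crossable :=
  dense_strong_of_rankOne_mem (M := S.crossableSubmodule) rankOne_mem_closure_crossable

theorem dense_weak_crossable [CompleteSpace H] : @Dense _ (weakTopology H) S.crossable := by
  intro T
  have h := dense_strong_crossable (S := S) T
  rw [@mem_closure_iff] at h ⊢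
  exact fun o ho => h o (strong_le_weak o ho)

/-! ### Closedness of the graph -/

theorem isClosed_graph_crossingMap [CompleteSpace H] {t : TopologicalSpace (BoundedOp H)}
    (ht : t ≤ weakTopology H) : IsClosed[@instTopologicalSpaceProd _ _ t t]
      (Set.range fun T : S.crossable => ((T : BoundedOp H), S.crossingMap T)) := by
  have hc : ∀ a b : TensorSq H, Continuous[t, inferInstance] fun T : BoundedOp H =>
      inner ℂ a (T b) := fun a b => continuous_le_dom ht (continuous_weak_inner a b)
  have he : (Set.range fun T : S.crossable => ((T : BoundedOp H), S.crossingMap T)) =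
      {p | S.IsCrossedVersion p.1 p.2} := Set.ext fun _ => mem_range_crossingMap_iff
  rw [he]
  simp only [IsCrossedVersion, Set.ofPred_forall]
  refine @isClosed_iInter _ _ (_) _ fun φ₁ => @isClosed_iInter _ _ (_) _ fun ψ₁ =>
    @isClosed_iInter _ _ (_) _ fun φ₂ => @isClosed_iInter _ _ (_) _ fun ψ₂ =>
    @isClosed_eq _ _ _ (_) inferInstance _ _ ?_ ?_
  · exact @Continuous.comp _ _ _ (_) t _ _ _ (hc _ _) (@continuous_fst _ _ t t)
  · exact @Continuous.comp _ _ _ (_) t _ _ _ (hc _ _) (@continuous_snd _ _ t t)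

/-! ### The finite-dimensional case -/

theorem crossable_eq_univ [FiniteDimensional ℂ H] : S.crossable = Set.univ := by
  have : CompleteSpace H := FiniteDimensional.complete ℂ H
  have hd : Dense (S.crossableSubmodule : Set (BoundedOp H)) := by
    have h := dense_weak_crossable (S := S)
    rw [weak_eq_norm] at h
    exact h
  have hc : IsClosed (S.crossableSubmodule : Set (BoundedOp H)) :=
    Submodule.closed_of_finiteDimensional _
  exact hc.closure_eq.symm.trans hd.closure_eq

theorem continuous_crossingMap [FiniteDimensional ℂ H] : Continuous S.crossingMap := by
  have : CompleteSpace H := FiniteDimensional.complete ℂ H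
  exact LinearMap.continuous_of_finiteDimensional S.crossingLinearMap

/-! ### The infinite-dimensional case -/

/-- Norm-to-weak continuity bounds each matrix element on the unit ball. Uniform boundedness,
applied first to vectors and then to operators, turns this into a norm bound. -/
theorem exists_norm_crossingMap_le [CompleteSpace H]
    (h : Continuous[inferInstance, weakTopology H] S.crossingMap) :
    ∃ C : ℝ, ∀ T X : BoundedOp H, S.IsCrossedVersion T X → ‖T‖ ≤ 1 → ‖X‖ ≤ C := by
  have h1 : ∀ a b : TensorSq H, ∃ C, ∀ T : {T : S.crossableSubmodule // ‖T‖ ≤ 1},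
      ‖inner ℂ a (S.crossingLinearMap T b)‖ ≤ C := fun a b => by
    let f : S.crossableSubmodule →ₗ[ℂ] ℂ :=
      { toFun := fun T => inner ℂ a (S.crossingLinearMap T b)
        map_add' := fun T T' => by rw [map_add, add_apply, inner_add_right]
        map_smul' := fun c T => by
          rw [map_smul, smul_apply, inner_smul_right, RingHom.id_apply, smul_eq_mul] }
    obtain ⟨C, hC⟩ := @exists_norm_le_of_continuous (BoundedOp H) ℂ _ _ _ _
      S.crossableSubmodule f
      (@Continuous.comp _ _ _ _ (weakTopology H) _ _ _ (continuous_weak_inner a b) h)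
    exact ⟨C, fun T => hC T T.2⟩
  have h2 : ∀ b : TensorSq H, ∃ C, ∀ T : {T : S.crossableSubmodule // ‖T‖ ≤ 1},
      ‖S.crossingLinearMap T b‖ ≤ C := fun b => by
    obtain ⟨C, hC⟩ := banach_steinhaus
      (g := fun T : {T : S.crossableSubmodule // ‖T‖ ≤ 1} => innerSL ℂ (S.crossingLinearMap T b))
      fun a => by
        obtain ⟨C, hC⟩ := h1 a b
        refine ⟨C, fun T => ?_⟩
        rw [innerSL_apply_apply, norm_inner_symm]
        exact hC T
    exact ⟨C, fun T => by simpa using hC T⟩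
  obtain ⟨C, hC⟩ := banach_steinhaus h2
  refine ⟨C, fun T X hX hT => ?_⟩
  have := hC ⟨⟨T, X, hX⟩, hT⟩
  rwa [show S.crossingLinearMap ⟨T, X, hX⟩ = X from
    (S.crossingMap_spec ⟨T, X, hX⟩).unique hX] at this

theorem continuous_crossingMap_of_isClosed [CompleteSpace H] (h : IsClosed S.crossable) :
    Continuous S.crossingMap :=
  @continuous_of_isClosed_submodule_of_isClosed_graph (BoundedOp H) (BoundedOp H) _ _ _ _ _ _
    S.crossableSubmodule h S.crossingLinearMap (isClosed_graph_crossingMap norm_le_weak)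

/-- The test operator is Σ |zᵢ ⊗ u⟩⟨zᵢ ⊗ u| with zᵢ orthonormal in dom S* and u a unit vector in dom
S. It crosses to |Σ S*zᵢ ⊗ zᵢ⟩⟨u ⊗ Su|, so Σ ‖S*zᵢ‖² ≤ C² whatever the number of terms. -/
theorem finiteDimensional_of_norm_le [CompleteSpace H] {K : ℝ}
    (hK : ∀ T X : BoundedOp H, S.IsCrossedVersion T X → ‖T‖ ≤ 1 → ‖X‖ ≤ K) :
    FiniteDimensional ℂ H := by
  by_contra hfin
  obtain ⟨u', hu'⟩ := exists_orthonormal_of_dense hfin S.dense_domain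
  obtain ⟨u, hu⟩ : ∃ u : S.op.domain, ‖(u : H)‖ = 1 := ⟨u' 0, hu'.1 0⟩
  have hSu : 0 < ‖S.op u‖ := by
    refine norm_pos_iff.2 fun h => ?_
    have e := S.map_map u
    have : (⟨S.op u, S.map_mem u⟩ : S.op.domain) = 0 := Subtype.ext h
    rw [this, LinearPMap.map_zero] at e
    rw [← e, norm_zero] at hu
    exact zero_ne_one hu
  obtain ⟨y, hy⟩ := exists_orthonormal_of_dense hfin S.dense_adjoint_domain
  set C := K / ‖S.op u‖
  have key : ∀ n : ℕ, ∀ z : Fin n → S.adjoint.domain, Orthonormal ℂ (fun i => (z i : H)) →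
      ∑ i, ‖S.adjoint (z i)‖ ^ 2 ≤ C ^ 2 := fun n z hz => by
    have hf : Orthonormal ℂ fun i => tmul (z i : H) (u : H) := by
      classical
      rw [orthonormal_iff_ite] at hz ⊢
      intro i j
      rw [inner_tmul_tmul, hz i j, inner_self_eq_norm_sq_to_K, hu]
      simp
    have h1 := hK _ _ (IsCrossedVersion.sum Finset.univ fun i =>
      isCrossedVersion_rankOne (z i : H) (u : H) u (z i)) (norm_sum_rankOne_le hf)
    have h2 : ∑ i, InnerProductSpace.rankOne ℂ (tmul (S.adjoint (z i)) (z i : H))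
        (tmul (u : H) (S.op u)) = InnerProductSpace.rankOne ℂ
          (∑ i, tmul (S.adjoint (z i)) (z i : H)) (tmul (u : H) (S.op u)) := by
      rw [map_sum, sum_apply]
    rw [h2, InnerProductSpace.norm_rankOne, norm_tmul, hu, one_mul, ← le_div_iff₀ hSu] at h1
    -- The second tensor factors are orthonormal, so the cross terms vanish.
    have h3 : ∑ i, ‖S.adjoint (z i)‖ ^ 2 = ‖∑ i, tmul (S.adjoint (z i)) (z i : H)‖ ^ 2 := by
      classical
      have e : ∀ w : TensorSq H, inner ℂ w w = (‖w‖ : ℂ) ^ 2 := inner_self_eq_norm_sq_to_K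
      rw [← Complex.ofReal_inj, Complex.ofReal_pow, ← e]
      rw [orthonormal_iff_ite] at hz
      simp only [sum_inner, inner_sum, inner_tmul_tmul, hz, mul_ite, mul_one, mul_zero,
        Finset.sum_ite_eq', Finset.mem_univ, if_true]
      simp [inner_self_eq_norm_sq_to_K]
    rw [h3]
    exact pow_le_pow_left₀ (norm_nonneg _) h1 2
  -- A single term already shows that S* is bounded; being an involution, it is then also bounded
  -- below.
  have hle : ∀ x : S.adjoint.domain, ‖(x : H)‖ = 1 → ‖S.adjoint x‖ ^ 2 ≤ C ^ 2 := fun x hx => by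
    simpa using key 1 (fun _ => x) ⟨fun _ => hx, fun i j hij => (hij (Subsingleton.elim i j)).elim⟩
  have hbd : ∀ x : S.adjoint.domain, ‖S.adjoint x‖ ^ 2 ≤ C ^ 2 * ‖(x : H)‖ ^ 2 := fun x => by
    rcases eq_or_ne x 0 with rfl | hx
    · simp
    have hx0 : 0 < ‖(x : H)‖ := norm_pos_iff.2 (by simpa using hx)
    have h1 := hle (((‖(x : H)‖⁻¹ : ℝ) : ℂ) • x) (by simp [norm_smul, hx0.ne'])
    rw [LinearPMap.map_smulₛₗ, norm_smul, mul_pow] at h1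
    simp only [Complex.conj_ofReal, Complex.norm_real, norm_inv, norm_norm, inv_pow] at h1
    rwa [inv_mul_le_iff₀ (by positivity), mul_comm] at h1
  have hge : ∀ x : S.adjoint.domain, ‖(x : H)‖ = 1 → 1 ≤ C ^ 2 * ‖S.adjoint x‖ ^ 2 :=
    fun x hx => by
      have h1 := hbd ⟨S.adjoint x, S.adjoint_mem x⟩
      rwa [S.adjoint_adjoint, hx, one_pow] at h1
  -- The lower bound for each of n terms and the upper bound C² for their sum give n ≤ C⁴.
  obtain ⟨n, hn⟩ := exists_nat_gt (C ^ 2 * C ^ 2)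
  have h4 := key n (fun i => y i) (hy.comp _ Fin.val_injective)
  have h5 : (n : ℝ) ≤ C ^ 2 * ∑ i : Fin n, ‖S.adjoint (y i)‖ ^ 2 := by
    rw [Finset.mul_sum]
    simpa using Finset.sum_le_sum fun (i : Fin n) (_ : i ∈ Finset.univ) => hge (y i) (hy.1 i)
  nlinarith [mul_le_mul_of_nonneg_left h4 (sq_nonneg C)]

end ClosedInvolution

end Crossing

end

theorem proposition2 {H : Type*} [NormedAddCommGroup H] [InnerProductSpace ℂ H] [CompleteSpace H]
    [TopologicalSpace.SeparableSpace H] (S : Crossing.ClosedInvolution H) :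
    -- a) the crossable operators form a dense complex linear subspace,
    -- on which the crossing map is linear and injective
    ((∃ L : Crossing.BoundedOp H →ₗ.[ℂ] Crossing.BoundedOp H,
        (L.domain : Set (Crossing.BoundedOp H)) = S.crossable ∧
        ∀ (T : S.crossable) (hT : (T : Crossing.BoundedOp H) ∈ L.domain),
          L ⟨T, hT⟩ = S.crossingMap T) ∧
      @Dense _ (Crossing.strongTopology H) S.crossable ∧
      @Dense _ (Crossing.weakTopology H) S.crossable ∧
      Function.Injective S.crossingMap) ∧
    -- b) the graph of the crossing map is closed in each of the three topologies
    (∀ t ∈ ({Crossing.normTopology H, Crossing.strongTopology H, Crossing.weakTopology H} :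
        Set (TopologicalSpace (Crossing.BoundedOp H))),
      IsClosed[@instTopologicalSpaceProd _ _ t t]
        (Set.range fun T : S.crossable => ((T : Crossing.BoundedOp H), S.crossingMap T))) ∧
    -- c) continuity of the crossing map and closedness of its domain
    (∀ t ∈ ({Crossing.normTopology H, Crossing.strongTopology H, Crossing.weakTopology H} :
        Set (TopologicalSpace (Crossing.BoundedOp H))),
      (Continuous[t.induced Subtype.val, t] S.crossingMap ↔ FiniteDimensional ℂ H) ∧
      (IsClosed[t] S.crossable ↔ FiniteDimensional ℂ H)) ∧
    (FiniteDimensional ℂ H → S.crossable = Set.univ) := by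
  open Crossing ClosedInvolution in
  refine ⟨⟨⟨⟨S.crossableSubmodule, S.crossingLinearMap⟩, rfl, fun _ _ => rfl⟩,
    dense_strong_crossable, dense_weak_crossable, crossingMap_injective⟩,
    fun t ht => isClosed_graph_crossingMap (norm_le_and_le_weak ht).2,
    fun t ht => ⟨⟨fun h => ?_, fun _ => ?_⟩, fun h => ?_, fun _ => ?_⟩,
    fun _ => crossable_eq_univ⟩ <;> obtain ⟨h1, h2⟩ := norm_le_and_le_weak ht
  · obtain ⟨C, hC⟩ := exists_norm_crossingMap_le (S := S)
      -- Refining the source to the norm topology and coarsening the target to the weak one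
      -- preserves continuity, so one bound serves all three cases.
      (continuous_le_rng h2 (continuous_le_dom (induced_mono h1) h))
    exact finiteDimensional_of_norm_le hC
  · obtain rfl : t = normTopology H := le_antisymm (h2.trans_eq weak_eq_norm) h1
    exact continuous_crossingMap
  · obtain ⟨C, hC⟩ := exists_norm_crossingMap_le (S := S)
      (continuous_le_rng norm_le_weak (continuous_crossingMap_of_isClosed (h.mono h1)))
    exact finiteDimensional_of_norm_le hC
  · rw [crossable_eq_univ]
    exact @isClosed_univ _ t
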